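/- Let $\mathcal X$ be a Polish space (a separable, completely metrizable topological space), let $\mathcal Y$ be a real separable Hilbert space, and let $T\colon\mathcal X\to\mathcal Y$ be admissible, i.e. Borel measurable, continuous and injective. Then the inverse multiquadric $T$ kernel $$k_T(x,y)=\bigl(\|T(x)-T(y)\|_{\mathcal Y}^2+1\bigr)^{-1/2},\qquad x,y\in\mathcal X,$$ is characteristic. That is: $k_T$ is a measurable kernel (symmetric and positive definite, meaning that for all $N$ and $x_1,\dots,x_N\in\mathcal X$ the matrix $(k_T(x_n,x_m))_{n,m=1}^N$ is positive semi-definite) and, writing $\mathcal H_{k_T}$ for its reproducing kernel Hilbert space and $\mathcal P$ for the set of all Borel probability measures on $\mathcal X$, the mean embedding $$\Phi_{k_T}\colon\mathcal P\to\mathcal H_{k_T},\qquad \Phi_{k_T}P=\int_{\mathcal X}k_T(\cdot,x)\,dP(x)$$ (a Bochner integral in $\mathcal H_{k_T}$) is defined for every $P\in\mathcal P$ and is injective on $\mathcal P$. -/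

import Mathlib

open MeasureTheory

namespace KernelMMD

/-- A (real, scalar) kernel on `X`: a symmetric function `k : X × X → ℝ` such that every matrix
`(k (xₙ, xₘ))ₙₘ` is positive semi-definite. -/
class IsKernel {X : Type*} (k : X → X → ℝ) : Prop where
  symm : ∀ x y, k x y = k y x
  posSemidef : ∀ (N : ℕ) (x : Fin N → X), (Matrix.of fun i j => k (x i) (x j)).PosSemidef

/-- The scalar kernel `k` in the form used by Mathlib's theory of reproducing kernel Hilbert
spaces: the entries are the operators on `ℝ` given by multiplication by `k x y`. -/
noncomputable def kernelMatrix {X : Type*} (k : X → X → ℝ) : Matrix X X (ℝ →L[ℝ] ℝ) :=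
  Matrix.of fun x y => k x y • (1 : ℝ →L[ℝ] ℝ)

theorem kernelMatrix_apply {X : Type*} (k : X → X → ℝ) (x y : X) (c : ℝ) :
    kernelMatrix k x y c = k x y * c := by
  simp [kernelMatrix]

theorem kernelMatrix_posSemidef {X : Type*} (k : X → X → ℝ) [hk : IsKernel k] :
    (kernelMatrix k).PosSemidef := by
  classical
  have tfae := RKHS.posSemidef_tfae (𝕜 := ℝ) (K := kernelMatrix k)
  have h02 := tfae.out 0 2 rfl rfl
  refine h02.mpr ⟨?_, fun v => ?_⟩
  · ext x y
    simp [kernelMatrix, hk.symm y x]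
  · have h := (hk.posSemidef v.support.card
      (fun i => (v.support.equivFin.symm i : X))).dotProduct_mulVec_nonneg
      (fun i => v (v.support.equivFin.symm i : X))
    have e : ∀ f : X → ℝ, ∑ i, f (v.support.equivFin.symm i : X) = ∑ x ∈ v.support, f x := by
      intro f
      rw [Equiv.sum_comp v.support.equivFin.symm (fun z => f (z : X))]
      exact Finset.sum_coe_sort v.support f
    simp only [dotProduct, Matrix.mulVec, Matrix.of_apply, Pi.star_apply, star_trivial] at h
    have e2 : ∀ x, ∑ i, k x (v.support.equivFin.symm i) * v (v.support.equivFin.symm i) =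
        ∑ y ∈ v.support, k x y * v y := fun x => e (fun y => k x y * v y)
    simp only [e2] at h
    rw [e (fun x => v x * ∑ y ∈ v.support, k x y * v y)] at h
    refine h.trans_eq ?_
    change _ = ∑ x ∈ v.support, ∑ y ∈ v.support, inner ℝ (kernelMatrix k y x (v x)) (v y)
    refine Finset.sum_congr rfl fun x _ => ?_
    rw [Finset.mul_sum]
    refine Finset.sum_congr rfl fun y _ => ?_
    rw [kernelMatrix_apply, hk.symm y x]
    simp only [RCLike.inner_apply, conj_trivial]
    ring

instance {X : Type*} (k : X → X → ℝ) [IsKernel k] : Fact (kernelMatrix k).PosSemidef :=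
  ⟨kernelMatrix_posSemidef k⟩

/-- The reproducing kernel Hilbert space `H_k` of the kernel `k`: the completion of the span of
the functions `k (·, x)`. Its elements are functions on `X` through `RKHS.instFunLike`. -/
abbrev HilbertSpaceOf {X : Type*} (k : X → X → ℝ) [IsKernel k] : Type _ :=
  RKHS.OfKernel (kernelMatrix k)

/-- The canonical feature `k (·, x)`, as an element of `H_k`. -/
noncomputable def feature {X : Type*} (k : X → X → ℝ) [IsKernel k] (x : X) : HilbertSpaceOf k :=
  RKHS.kerFun (HilbertSpaceOf k) x 1

/-- As a function on `X`, `feature k x` is `k (·, x)`. -/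
theorem feature_apply {X : Type*} (k : X → X → ℝ) [IsKernel k] (x y : X) :
    feature k x y = k y x := by
  rw [feature, RKHS.kerFun_apply, RKHS.OfKernel.kernel_ofKernel, kernelMatrix_apply, mul_one]

/-- The reproducing property. -/
theorem inner_feature {X : Type*} (k : X → X → ℝ) [IsKernel k] (f : HilbertSpaceOf k) (x : X) :
    inner ℝ f (feature k x) = f x := by
  simp [feature]

/-- The norm of `k (·, x)` in `H_k` is `k (x, x) ^ (1 / 2)`. -/
theorem norm_feature {X : Type*} (k : X → X → ℝ) [IsKernel k] (x : X) :
    ‖feature k x‖ = √(k x x) := by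
  rw [norm_eq_sqrt_real_inner, inner_feature, feature_apply]

/-- The mean embedding `Φ_k P = ∫ k (·, x) dP(x)`, a Bochner integral in `H_k`. -/
noncomputable def meanEmbedding {X : Type*} [MeasurableSpace X] (k : X → X → ℝ) [IsKernel k]
    (P : ProbabilityMeasure X) : HilbertSpaceOf k :=
  ∫ x, feature k x ∂(P : Measure X)

/-- `k` is a measurable kernel that is characteristic: the mean embedding is defined at every
probability measure (the Bochner integral exists; by `norm_feature` this contains
`∫ k (x, x) ^ (1 / 2) dP(x) < ∞`), and it is injective on the set of all probability measures. -/
def IsCharacteristic {X : Type*} [MeasurableSpace X] (k : X → X → ℝ) : Prop :=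
  ∃ _ : IsKernel k, Measurable (Function.uncurry k) ∧
    (∀ P : ProbabilityMeasure X, Integrable (feature k) (P : Measure X)) ∧
    Function.Injective (meanEmbedding k : ProbabilityMeasure X → HilbertSpaceOf k)

/-- Admissible maps: Borel measurable, continuous and injective. -/
structure IsAdmissible {X Y : Type*} [TopologicalSpace X] [MeasurableSpace X]
    [TopologicalSpace Y] [MeasurableSpace Y] (T : X → Y) : Prop where
  measurable : Measurable T
  continuous : Continuous T
  injective : Function.Injective T

/-- The inverse multiquadric kernel `(‖T x - T y‖² + 1) ^ (-1/2)`. -/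
noncomputable def imqKernel {X Y : Type*} [NormedAddCommGroup Y] (T : X → Y) (x y : X) : ℝ :=
  (‖T x - T y‖ ^ 2 + 1) ^ (-(1 / 2) : ℝ)

end KernelMMD

/-!
The inverse multiquadric kernel is a mixture of Gaussian kernels: if `γ` is the gamma distribution
with shape `1/2` and rate `1`, then `(r² + 1) ^ (-1/2) = ∫ exp (-s r²) dγ(s)`. Hence the squared
distance between the mean embeddings of `P` and `Q`, which is the double integral of the kernel
against `(P - Q) ⊗ (P - Q)` (`norm_integral_feature_sub_sq`), is the average over `γ` of the same
quantity for the Gaussian kernels with parameters `s > 0` and the image measures `μ = T_* P` and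
`ν = T_* Q` on `Y` (`sqMMD_comp`, `sqMMD_imqKernel_id`). These are nonnegative, because Gaussian
kernels on a Hilbert space are positive definite. So if the embeddings of `P` and `Q` agree, then
for some `s > 0` so do the Gaussian embeddings of `μ` and `ν`.

As a function of `b`, the Gaussian embedding is `∫ exp (-s ‖b - u‖²) dμ(u)`, which up to a factor
depending on `b` only is the Laplace transform at `2 s b` of `exp (-s ‖u‖²) dμ(u)`. Laplace
transforms that are finite everywhere continue analytically to characteristic functions, and these
determine finite measures on a separable Hilbert space, so `μ = ν`
(`ext_of_integral_gaussianKernel`). Finally, `T` is a measurable embedding by the Lusin–Souslin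
theorem, so `P = Q`.
-/

namespace KernelMMD

open ProbabilityTheory

/-! ### Positive definiteness through quadratic forms -/

theorem IsKernel.of_sum_nonneg {X : Type*} {k : X → X → ℝ} (hsymm : ∀ x y, k x y = k y x)
    (hk : ∀ (N : ℕ) (x : Fin N → X) (c : Fin N → ℝ),
      0 ≤ ∑ i, ∑ j, c i * c j * k (x i) (x j)) : IsKernel k where
  symm := hsymm
  posSemidef N x := by
    refine .of_dotProduct_mulVec_nonneg ?_ fun c => ?_
    · ext i j
      simp [hsymm (x j) (x i)]
    · refine (hk N x c).trans_eq ?_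
      simp only [dotProduct, Matrix.mulVec, Matrix.of_apply, Pi.star_apply, star_trivial,
        Finset.mul_sum]
      exact Finset.sum_congr rfl fun i _ => Finset.sum_congr rfl fun j _ => by ring

theorem IsKernel.sum_nonneg {X : Type*} {k : X → X → ℝ} (hk : IsKernel k) {N : ℕ}
    (x : Fin N → X) (c : Fin N → ℝ) : 0 ≤ ∑ i, ∑ j, c i * c j * k (x i) (x j) := by
  have h := (hk.posSemidef N x).dotProduct_mulVec_nonneg c
  refine h.trans_eq ?_
  simp only [dotProduct, Matrix.mulVec, Matrix.of_apply, Pi.star_apply, star_trivial,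
    Finset.mul_sum]
  exact Finset.sum_congr rfl fun i _ => Finset.sum_congr rfl fun j _ => by ring

/-! ### The Gaussian kernel -/

/-- The Gaussian kernel `exp (-s ‖u - v‖²)` with parameter `s` on a normed space. -/
noncomputable def gaussianKernel {Y : Type*} [NormedAddCommGroup Y] (s : ℝ) (u v : Y) : ℝ :=
  Real.exp (-(s * ‖u - v‖ ^ 2))

section Gaussian

variable {Y : Type*} [NormedAddCommGroup Y]

theorem gaussianKernel_nonneg (s : ℝ) (u v : Y) : 0 ≤ gaussianKernel s u v :=
  (Real.exp_pos _).le

theorem gaussianKernel_le_one {s : ℝ} (hs : 0 ≤ s) (u v : Y) : gaussianKernel s u v ≤ 1 := by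
  rw [gaussianKernel, Real.exp_le_one_iff]
  have : 0 ≤ s * ‖u - v‖ ^ 2 := by positivity
  linarith

theorem abs_gaussianKernel_le_one {s : ℝ} (hs : 0 ≤ s) (u v : Y) : |gaussianKernel s u v| ≤ 1 := by
  rw [abs_of_nonneg (gaussianKernel_nonneg s u v)]
  exact gaussianKernel_le_one hs u v

theorem continuous_gaussianKernel (s : ℝ) :
    Continuous (Function.uncurry (gaussianKernel (Y := Y) s)) := by
  unfold gaussianKernel Function.uncurry
  fun_prop

variable [InnerProductSpace ℝ Y]

theorem posSemidef_inner_pow {N : ℕ} (x : Fin N → Y) (n : ℕ) :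
    (Matrix.of fun i j => (inner ℝ (x i) (x j)) ^ n).PosSemidef := by
  induction n with
  | zero =>
    refine .of_dotProduct_mulVec_nonneg (by ext; simp) fun c => ?_
    refine (mul_self_nonneg (∑ i, c i)).trans_eq ?_
    simp [dotProduct, Matrix.mulVec, Finset.sum_mul]
  | succ n ih =>
    have h1 : (Matrix.of fun i j => inner ℝ (x i) (x j)).PosSemidef :=
      Matrix.posSemidef_gram ℝ x
    have h := ih.hadamard h1
    convert! h using 1

theorem gaussianKernel_eq_mul (s : ℝ) (u v : Y) :
    gaussianKernel s u v =
      Real.exp (-(s * ‖u‖ ^ 2)) * Real.exp (-(s * ‖v‖ ^ 2)) * Real.exp (2 * s * inner ℝ u v) := by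
  rw [gaussianKernel, ← Real.exp_add, ← Real.exp_add, norm_sub_sq_real]
  ring_nf

/-- The Gaussian kernel is, up to a factor `f u * f v`, the exponential series in `⟪u, v⟫`, whose
terms are positive semi-definite by the Schur product theorem. -/
theorem isKernel_gaussianKernel {s : ℝ} (hs : 0 ≤ s) : IsKernel (gaussianKernel (Y := Y) s) := by
  refine .of_sum_nonneg (fun u v => by rw [gaussianKernel, gaussianKernel, norm_sub_rev])
    fun N x c => ?_
  set d : Fin N → ℝ := fun i => c i * Real.exp (-(s * ‖x i‖ ^ 2))
  have hsum : HasSum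
      (fun n : ℕ => ∑ i, ∑ j, d i * d j * ((2 * s * inner ℝ (x i) (x j)) ^ n / n.factorial))
      (∑ i, ∑ j, c i * c j * gaussianKernel s (x i) (x j)) := by
    refine hasSum_sum fun i _ => hasSum_sum fun j _ => ?_
    have h := (NormedSpace.expSeries_div_hasSum_exp (2 * s * inner ℝ (x i) (x j))).mul_left
      (d i * d j)
    rw [← Real.exp_eq_exp_ℝ] at h
    convert! h using 1
    rw [gaussianKernel_eq_mul]
    ring
  refine hsum.nonneg fun n => ?_
  have h := (posSemidef_inner_pow x n).dotProduct_mulVec_nonneg d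
  have h2 : 0 ≤ (2 * s) ^ n / n.factorial := by positivity
  refine (mul_nonneg h2 h).trans_eq ?_
  simp only [dotProduct, Matrix.mulVec, Matrix.of_apply, Pi.star_apply, star_trivial,
    Finset.mul_sum]
  refine Finset.sum_congr rfl fun i _ => Finset.sum_congr rfl fun j _ => ?_
  rw [mul_pow]
  ring

end Gaussian

/-! ### Laplace transforms of finite measures on a Hilbert space -/

/-- A finite measure whose Laplace transform is finite everywhere is determined by it: along each
line the moment generating function extends analytically to the imaginary axis, where it is the
characteristic function. -/
theorem ext_of_integral_exp_inner {Y : Type*} [NormedAddCommGroup Y] [InnerProductSpace ℝ Y]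
    [CompleteSpace Y] [SecondCountableTopology Y] [MeasurableSpace Y] [BorelSpace Y]
    {μ ν : Measure Y} [IsFiniteMeasure μ] [IsFiniteMeasure ν]
    (hμ : ∀ a : Y, Integrable (fun u => Real.exp (inner ℝ u a)) μ)
    (h : ∀ a : Y, ∫ u, Real.exp (inner ℝ u a) ∂μ = ∫ u, Real.exp (inner ℝ u a) ∂ν) :
    μ = ν := by
  refine Measure.ext_of_charFun (funext fun a => ?_)
  have hmgf : mgf (fun u => inner ℝ u a) μ = mgf (fun u => inner ℝ u a) ν := by
    ext t
    have := h (t • a)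
    simpa only [mgf, inner_smul_right] using this
  -- `mgf` is `0` both for the zero measure and, as a junk value, for a divergent integral, so
  -- equal `mgf`s have equal domains only if the measures are both zero or both nonzero.
  have hmass : μ = 0 ↔ ν = 0 := by
    have h0 := h 0
    simp only [inner_zero_right, Real.exp_zero, integral_const, smul_eq_mul, mul_one] at h0
    rw [← Measure.measure_univ_eq_zero, ← Measure.measure_univ_eq_zero, ← measureReal_eq_zero_iff,
      ← measureReal_eq_zero_iff, h0]
  -- The strip on which the complex moment generating functions agree is all of `ℂ`.
  have hset : integrableExpSet (fun u => inner ℝ u a) μ = Set.univ := by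
    refine Set.eq_univ_of_forall fun t => ?_
    have := hμ (t • a)
    simpa only [integrableExpSet, Set.mem_ofPred_eq, inner_smul_right] using this
  have heq := eqOn_complexMGF_of_mgf' hmgf hmass (x := Complex.I) (by simp [hset])
  simp only [complexMGF] at heq
  simp only [charFun_apply]
  simpa only [mul_comm] using heq

/-- The functions `gaussianKernel s b`, for one fixed `s > 0`, determine a finite measure. Up to a
factor that depends on `b` only, the integral of `gaussianKernel s b` is the Laplace transform at
`2 s b` of the measure with the weight `exp (-s ‖u‖²)`. -/
theorem ext_of_integral_gaussianKernel {Y : Type*} [NormedAddCommGroup Y] [InnerProductSpace ℝ Y]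
    [CompleteSpace Y] [SecondCountableTopology Y] [MeasurableSpace Y] [BorelSpace Y]
    {μ ν : Measure Y} [IsFiniteMeasure μ] [IsFiniteMeasure ν] {s : ℝ} (hs : 0 < s)
    (h : ∀ b : Y, ∫ u, gaussianKernel s b u ∂μ = ∫ u, gaussianKernel s b u ∂ν) : μ = ν := by
  set w : Y → ENNReal := fun u => ENNReal.ofReal (Real.exp (-(s * ‖u‖ ^ 2)))
  have hw : Measurable w := by fun_prop
  have hw0 : ∀ u, w u ≠ 0 := fun u => by simp [w, Real.exp_pos]
  have hwtop : ∀ u, w u ≠ ⊤ := fun u => ENNReal.ofReal_ne_top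
  have hwreal : ∀ u, (w u).toReal = Real.exp (-(s * ‖u‖ ^ 2)) := fun u =>
    ENNReal.toReal_ofReal (Real.exp_pos _).le
  have hfin : ∀ ρ : Measure Y, IsFiniteMeasure ρ → IsFiniteMeasure (ρ.withDensity w) := by
    intro ρ _
    refine isFiniteMeasure_withDensity_ofReal (Integrable.of_bound (C := 1) ?_ ?_).2
    · fun_prop
    · refine .of_forall fun u => ?_
      rw [Real.norm_of_nonneg (Real.exp_pos _).le, Real.exp_le_one_iff]
      have : 0 ≤ s * ‖u‖ ^ 2 := by positivity
      linarith
  -- Completing the square.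
  have key : ∀ a u : Y, (w u).toReal • Real.exp (inner ℝ u a) =
      Real.exp (s * ‖(1 / (2 * s)) • a‖ ^ 2) * gaussianKernel s ((1 / (2 * s)) • a) u := by
    intro a u
    rw [hwreal, gaussianKernel_eq_mul, smul_eq_mul, ← Real.exp_add, ← Real.exp_add, ← Real.exp_add,
      ← Real.exp_add, inner_smul_left, real_inner_comm]
    congr 1
    simp only [conj_trivial]
    field_simp
    ring
  have hint : ∀ a : Y, Integrable (fun u => Real.exp (inner ℝ u a)) (μ.withDensity w) := by
    intro a
    rw [integrable_withDensity_iff_integrable_smul' hw (.of_forall fun u => (hwtop u).lt_top)]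
    simp only [key]
    refine Integrable.const_mul (Integrable.of_bound (C := 1) ?_ ?_) _
    · exact ((continuous_gaussianKernel s).comp
        (Continuous.prodMk_right _)).aestronglyMeasurable
    · exact .of_forall fun u => abs_gaussianKernel_le_one hs.le _ _
  have := hfin μ inferInstance
  have := hfin ν inferInstance
  -- The positive finite weight `w` can be divided out again.
  have heq : μ.withDensity w = ν.withDensity w := by
    refine ext_of_integral_exp_inner hint fun a => ?_
    rw [integral_withDensity_eq_integral_toReal_smul hw (.of_forall fun u => (hwtop u).lt_top),
      integral_withDensity_eq_integral_toReal_smul hw (.of_forall fun u => (hwtop u).lt_top)]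
    simp only [key, integral_const_mul, h]
  rw [← withDensity_inv_same hw (.of_forall hw0) (.of_forall hwtop) (μ := μ), heq,
    withDensity_inv_same hw (.of_forall hw0) (.of_forall hwtop)]

/-! ### Mean embeddings of continuous bounded kernels -/

/-- The squared maximum mean discrepancy of `P` and `Q`, written as a double integral of the kernel
against `(P - Q) ⊗ (P - Q)`. -/
noncomputable def sqMMD {X : Type*} [MeasurableSpace X] (k : X → X → ℝ) (P Q : Measure X) : ℝ :=
  (∫ z, k z.1 z.2 ∂(P.prod P)) - 2 * (∫ z, k z.1 z.2 ∂(P.prod Q)) + ∫ z, k z.1 z.2 ∂(Q.prod Q)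

section Embedding

variable {X : Type*} [TopologicalSpace X]

theorem continuous_feature (k : X → X → ℝ) [IsKernel k]
    (hc : Continuous (Function.uncurry k)) : Continuous (feature k) := by
  refine continuous_iff_continuousAt.2 fun x => ?_
  rw [ContinuousAt, tendsto_iff_norm_sub_tendsto_zero]
  have hn : ∀ y, ‖feature k y - feature k x‖ = √(k y y - 2 * k x y + k x x) := by
    intro y
    have h := norm_sub_sq_real (feature k y) (feature k x)
    rw [inner_feature, feature_apply, ← real_inner_self_eq_norm_sq (feature k y),
      ← real_inner_self_eq_norm_sq (feature k x), inner_feature, inner_feature,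
      feature_apply, feature_apply] at h
    rw [← h, Real.sqrt_sq (norm_nonneg _)]
  simp only [hn]
  have h1 : Continuous fun y => √(k y y - 2 * k x y + k x x) := by
    have ha : Continuous fun y => k y y := hc.comp (continuous_id.prodMk continuous_id)
    have hb : Continuous fun y => k x y := hc.comp (Continuous.prodMk_right x)
    fun_prop
  have h2 := h1.tendsto x
  have h3 : k x x - 2 * k x x + k x x = 0 := by ring
  rwa [h3, Real.sqrt_zero] at h2

variable [SecondCountableTopology X] [MeasurableSpace X] [BorelSpace X]

theorem integrable_feature (k : X → X → ℝ) [IsKernel k]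
    (hc : Continuous (Function.uncurry k)) {C : ℝ} (hb : ∀ x y, |k x y| ≤ C)
    (P : Measure X) [IsFiniteMeasure P] : Integrable (feature k) P := by
  refine Integrable.of_bound (C := √C) (continuous_feature k hc).aestronglyMeasurable
    (.of_forall fun x => ?_)
  rw [norm_feature]
  exact Real.sqrt_le_sqrt ((le_abs_self _).trans (hb x x))

theorem integrable_uncurry {k : X → X → ℝ} (hc : Continuous (Function.uncurry k)) {C : ℝ}
    (hb : ∀ x y, |k x y| ≤ C) (R : Measure (X × X)) [IsFiniteMeasure R] :
    Integrable (fun z : X × X => k z.1 z.2) R :=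
  Integrable.of_bound (C := C) hc.aestronglyMeasurable (.of_forall fun z => hb z.1 z.2)

/-- The mean embedding is the function `y ↦ ∫ k y x dP(x)`. -/
theorem integral_feature_apply (k : X → X → ℝ) [IsKernel k]
    (hc : Continuous (Function.uncurry k)) {C : ℝ} (hb : ∀ x y, |k x y| ≤ C)
    (P : Measure X) [IsFiniteMeasure P] (y : X) :
    (∫ x, feature k x ∂P : HilbertSpaceOf k) y = ∫ x, k y x ∂P := by
  rw [← inner_feature, real_inner_comm, ← integral_inner (integrable_feature k hc hb P)]
  refine integral_congr_ae (.of_forall fun x => ?_)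
  change inner ℝ (feature k y) (feature k x) = _
  rw [real_inner_comm, inner_feature, feature_apply]

theorem inner_integral_feature (k : X → X → ℝ) [IsKernel k]
    (hc : Continuous (Function.uncurry k)) {C : ℝ} (hb : ∀ x y, |k x y| ≤ C)
    (P Q : Measure X) [IsFiniteMeasure P] [IsFiniteMeasure Q] :
    inner ℝ (∫ x, feature k x ∂Q) (∫ x, feature k x ∂P) = ∫ z, k z.1 z.2 ∂(P.prod Q) := by
  rw [← integral_inner (integrable_feature k hc hb P), integral_prod _ (integrable_uncurry hc hb _)]
  refine integral_congr_ae (.of_forall fun x => ?_)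
  change inner ℝ _ (feature k x) = _
  rw [inner_feature, integral_feature_apply k hc hb]

theorem norm_integral_feature_sub_sq (k : X → X → ℝ) [IsKernel k]
    (hc : Continuous (Function.uncurry k)) {C : ℝ} (hb : ∀ x y, |k x y| ≤ C)
    (P Q : Measure X) [IsFiniteMeasure P] [IsFiniteMeasure Q] :
    ‖(∫ x, feature k x ∂P) - ∫ x, feature k x ∂Q‖ ^ 2 = sqMMD k P Q := by
  rw [norm_sub_sq_real, real_inner_comm, ← real_inner_self_eq_norm_sq,
    ← real_inner_self_eq_norm_sq, inner_integral_feature k hc hb,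
    inner_integral_feature k hc hb, inner_integral_feature k hc hb, sqMMD]

end Embedding

theorem sqMMD_comp {X Y : Type*} [MeasurableSpace X] [TopologicalSpace Y]
    [SecondCountableTopology Y] [MeasurableSpace Y] [BorelSpace Y] {T : X → Y}
    (hT : Measurable T) {k : Y → Y → ℝ} (hc : Continuous (Function.uncurry k)) (P Q : Measure X)
    [IsFiniteMeasure P] [IsFiniteMeasure Q] :
    sqMMD (fun x y => k (T x) (T y)) P Q = sqMMD k (P.map T) (Q.map T) := by
  have h : ∀ R S : Measure X, IsFiniteMeasure R → IsFiniteMeasure S →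
      ∫ z, k z.1 z.2 ∂((R.map T).prod (S.map T)) = ∫ z, k (T z.1) (T z.2) ∂(R.prod S) := by
    intro R S _ _
    rw [Measure.map_prod_map _ _ hT hT, integral_map (hT.prodMap hT).aemeasurable]
    · rfl
    · exact hc.aestronglyMeasurable
  simp only [sqMMD, h _ _ ‹IsFiniteMeasure P› ‹IsFiniteMeasure P›,
    h _ _ ‹IsFiniteMeasure P› ‹IsFiniteMeasure Q›, h _ _ ‹IsFiniteMeasure Q› ‹IsFiniteMeasure Q›]

/-- Gaussian kernels on a separable Hilbert space are characteristic. -/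
theorem eq_of_sqMMD_gaussianKernel_eq_zero {Y : Type*} [NormedAddCommGroup Y]
    [InnerProductSpace ℝ Y] [CompleteSpace Y] [SecondCountableTopology Y] [MeasurableSpace Y]
    [BorelSpace Y] {μ ν : Measure Y} [IsFiniteMeasure μ] [IsFiniteMeasure ν] {s : ℝ} (hs : 0 < s)
    (h : sqMMD (gaussianKernel s) μ ν = 0) : μ = ν := by
  have hk := isKernel_gaussianKernel (Y := Y) hs.le
  have hc := continuous_gaussianKernel (Y := Y) s
  have hb := abs_gaussianKernel_le_one (Y := Y) hs.le
  rw [← norm_integral_feature_sub_sq _ hc hb, sq_eq_zero_iff, norm_sub_eq_zero_iff] at h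
  refine ext_of_integral_gaussianKernel hs fun b => ?_
  rw [← integral_feature_apply _ hc hb, ← integral_feature_apply _ hc hb, h]

/-! ### The inverse multiquadric kernel as a mixture of Gaussian kernels -/

theorem measurable_gammaPDF (a r : ℝ) : Measurable (gammaPDF a r) :=
  (measurable_gammaPDFReal a r).ennreal_ofReal

theorem ae_gammaMeasure_pos (a r : ℝ) : ∀ᵐ s ∂gammaMeasure a r, 0 < s := by
  have h0 : ∀ᵐ s ∂gammaMeasure a r, s ≠ 0 :=
    (withDensity_absolutelyContinuous _ _).ae_le (Measure.ae_ne volume 0)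
  have h1 : ∀ᵐ s ∂gammaMeasure a r, 0 ≤ s := by
    rw [gammaMeasure, ae_withDensity_iff (measurable_gammaPDF a r)]
    refine .of_forall fun s hs => ?_
    by_contra! hneg
    exact hs (gammaPDF_of_neg hneg)
  filter_upwards [h0, h1] with s hs0 hs1
  exact lt_of_le_of_ne hs1 hs0.symm

/-- The Laplace transform of the gamma distribution with shape `a` and rate `1`. -/
theorem integral_exp_neg_mul_gammaMeasure {a t : ℝ} (ha : 0 < a) (ht : 0 ≤ t) :
    ∫ s, Real.exp (-(s * t)) ∂gammaMeasure a 1 = (t + 1) ^ (-a) := by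
  have ht1 : 0 < t + 1 := by linarith
  have hpos := Real.Gamma_pos_of_pos ha
  rw [gammaMeasure, integral_withDensity_eq_integral_toReal_smul
    (measurable_gammaPDF a 1) (.of_forall fun _ => ENNReal.ofReal_lt_top)]
  have h1 : ∀ s : ℝ, (gammaPDF a 1 s).toReal • Real.exp (-(s * t)) =
      (Set.Ici (0 : ℝ)).indicator
        (fun s => (Real.Gamma a)⁻¹ * (s ^ (a - 1) * Real.exp (-((t + 1) * s)))) s := by
    intro s
    rw [gammaPDF, ENNReal.toReal_ofReal (gammaPDFReal_nonneg ha one_pos s), gammaPDFReal,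
      Set.indicator_apply]
    simp only [Set.mem_Ici]
    split_ifs
    · rw [show -((t + 1) * s) = -(1 * s) + -(s * t) by ring, Real.exp_add, Real.one_rpow,
        smul_eq_mul]
      ring
    · simp
  simp only [h1]
  rw [integral_indicator measurableSet_Ici, integral_Ici_eq_integral_Ioi, integral_const_mul,
    Real.integral_rpow_mul_exp_neg_mul_Ioi ha ht1, one_div, Real.inv_rpow ht1.le,
    Real.rpow_neg ht1.le]
  field_simp

section Imq

variable {Y : Type*} [NormedAddCommGroup Y]

theorem imqKernel_id_eq_integral (u v : Y) :
    imqKernel id u v = ∫ s, gaussianKernel s u v ∂gammaMeasure (1 / 2) 1 := by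
  simp only [gaussianKernel, imqKernel, id]
  rw [integral_exp_neg_mul_gammaMeasure (by norm_num) (by positivity)]

theorem continuous_imqKernel {X : Type*} [TopologicalSpace X] {T : X → Y} (hT : Continuous T) :
    Continuous (Function.uncurry (imqKernel T)) := by
  unfold imqKernel Function.uncurry
  refine Continuous.rpow_const (by fun_prop) fun z => Or.inl ?_
  positivity

theorem abs_imqKernel_le_one {X : Type*} (T : X → Y) (x y : X) : |imqKernel T x y| ≤ 1 := by
  have h : 0 ≤ imqKernel T x y := by unfold imqKernel; positivity
  rw [abs_of_nonneg h]
  refine Real.rpow_le_one_of_one_le_of_nonpos ?_ (by norm_num)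
  have : 0 ≤ ‖T x - T y‖ ^ 2 := by positivity
  linarith

instance : IsProbabilityMeasure (gammaMeasure (1 / 2) 1) :=
  isProbabilityMeasure_gammaMeasure (by norm_num) one_pos

theorem integrable_gaussianKernel_gammaMeasure (u v : Y) :
    Integrable (fun s => gaussianKernel s u v) (gammaMeasure (1 / 2) 1) := by
  refine Integrable.of_bound (C := 1) ?_ ?_
  · unfold gaussianKernel
    fun_prop
  · filter_upwards [ae_gammaMeasure_pos (1 / 2) 1] with s hs
    exact abs_gaussianKernel_le_one hs.le u v

theorem isKernel_imqKernel [InnerProductSpace ℝ Y] {X : Type*} (T : X → Y) :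
    IsKernel (imqKernel T) := by
  refine .of_sum_nonneg (fun x y => by rw [imqKernel, imqKernel, norm_sub_rev]) fun N x c => ?_
  have h : ∑ i, ∑ j, c i * c j * imqKernel T (x i) (x j) =
      ∫ s, ∑ i, ∑ j, c i * c j * gaussianKernel s (T (x i)) (T (x j))
        ∂gammaMeasure (1 / 2) 1 := by
    have hi : ∀ i j, Integrable (fun s => c i * c j * gaussianKernel s (T (x i)) (T (x j)))
        (gammaMeasure (1 / 2) 1) := fun i j =>
      (integrable_gaussianKernel_gammaMeasure _ _).const_mul _
    rw [integral_finsetSum _ fun i _ => integrable_finsetSum _ fun j _ => hi i j]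
    refine Finset.sum_congr rfl fun i _ => ?_
    rw [integral_finsetSum _ fun j _ => hi i j]
    refine Finset.sum_congr rfl fun j _ => ?_
    rw [integral_const_mul, ← imqKernel_id_eq_integral]
    rfl
  rw [h]
  refine integral_nonneg_of_ae ?_
  filter_upwards [ae_gammaMeasure_pos (1 / 2) 1] with s hs
  exact (isKernel_gaussianKernel hs.le).sum_nonneg (fun i => T (x i)) c

variable [SecondCountableTopology Y] [MeasurableSpace Y] [BorelSpace Y]

theorem integrable_gaussianKernel_prod (ρ : Measure (Y × Y)) [IsFiniteMeasure ρ] :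
    Integrable (fun p : (Y × Y) × ℝ => gaussianKernel p.2 p.1.1 p.1.2)
      (ρ.prod (gammaMeasure (1 / 2) 1)) := by
  refine Integrable.of_bound (C := 1) ?_ ?_
  · refine Continuous.aestronglyMeasurable ?_
    unfold gaussianKernel
    fun_prop
  · filter_upwards [Measure.quasiMeasurePreserving_snd.ae (ae_gammaMeasure_pos (1 / 2) 1)] with p hp
    exact abs_gaussianKernel_le_one hp.le _ _

theorem integral_imqKernel_id (ρ : Measure (Y × Y)) [IsFiniteMeasure ρ] :
    ∫ z, imqKernel id z.1 z.2 ∂ρ =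
      ∫ s, ∫ z, gaussianKernel s z.1 z.2 ∂ρ ∂gammaMeasure (1 / 2) 1 := by
  simp only [imqKernel_id_eq_integral]
  exact integral_integral_swap (integrable_gaussianKernel_prod ρ)

theorem integrable_integral_gaussianKernel (ρ : Measure (Y × Y)) [IsFiniteMeasure ρ] :
    Integrable (fun s => ∫ z, gaussianKernel s z.1 z.2 ∂ρ) (gammaMeasure (1 / 2) 1) :=
  (integrable_gaussianKernel_prod ρ).integral_prod_right

theorem integrable_sqMMD_gaussianKernel (μ ν : Measure Y) [IsFiniteMeasure μ] [IsFiniteMeasure ν] :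
    Integrable (fun s => sqMMD (gaussianKernel s) μ ν) (gammaMeasure (1 / 2) 1) :=
  ((integrable_integral_gaussianKernel _).sub
    ((integrable_integral_gaussianKernel _).const_mul 2)).add (integrable_integral_gaussianKernel _)

theorem sqMMD_imqKernel_id (μ ν : Measure Y) [IsFiniteMeasure μ] [IsFiniteMeasure ν] :
    sqMMD (imqKernel id) μ ν = ∫ s, sqMMD (gaussianKernel s) μ ν ∂gammaMeasure (1 / 2) 1 := by
  have h (ρ : Measure (Y × Y)) [IsFiniteMeasure ρ] := integrable_integral_gaussianKernel ρ
  have hsub : Integrable (fun s => (∫ z, gaussianKernel s z.1 z.2 ∂(μ.prod μ)) -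
      2 * ∫ z, gaussianKernel s z.1 z.2 ∂(μ.prod ν)) (gammaMeasure (1 / 2) 1) :=
    (h _).sub ((h _).const_mul 2)
  simp only [sqMMD]
  rw [integral_add hsub (h _), integral_sub (h _) ((h _).const_mul 2), integral_const_mul,
    integral_imqKernel_id, integral_imqKernel_id, integral_imqKernel_id]

/-- The discrepancy for the inverse multiquadric kernel is an average of nonnegative discrepancies
for Gaussian kernels, so if it vanishes then one of those vanishes too. -/
theorem eq_of_sqMMD_imqKernel_id_eq_zero [InnerProductSpace ℝ Y] [CompleteSpace Y]
    {μ ν : Measure Y} [IsFiniteMeasure μ] [IsFiniteMeasure ν]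
    (h : sqMMD (imqKernel id) μ ν = 0) : μ = ν := by
  have hnonneg : 0 ≤ᵐ[gammaMeasure (1 / 2) 1] fun s => sqMMD (gaussianKernel s) μ ν := by
    filter_upwards [ae_gammaMeasure_pos (1 / 2) 1] with s hs
    have hk := isKernel_gaussianKernel (Y := Y) hs.le
    change 0 ≤ sqMMD (gaussianKernel s) μ ν
    rw [← norm_integral_feature_sub_sq _ (continuous_gaussianKernel s)
      (abs_gaussianKernel_le_one hs.le)]
    positivity
  rw [sqMMD_imqKernel_id,
    integral_eq_zero_iff_of_nonneg_ae hnonneg (integrable_sqMMD_gaussianKernel μ ν)] at h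
  obtain ⟨s, hs, h0⟩ := ((ae_gammaMeasure_pos (1 / 2) 1).and h).exists
  exact eq_of_sqMMD_gaussianKernel_eq_zero hs h0

end Imq

end KernelMMD

theorem corollary4p6 {X Y : Type*}
    [TopologicalSpace X] [PolishSpace X] [MeasurableSpace X] [BorelSpace X]
    [NormedAddCommGroup Y] [InnerProductSpace ℝ Y] [CompleteSpace Y]
    [TopologicalSpace.SeparableSpace Y] [MeasurableSpace Y] [BorelSpace Y]
    (T : X → Y) (hT : KernelMMD.IsAdmissible T) :
    KernelMMD.IsCharacteristic (KernelMMD.imqKernel T) := by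
  have : SecondCountableTopology Y := UniformSpace.secondCountable_of_separable Y
  have hk := KernelMMD.isKernel_imqKernel T
  have hc := KernelMMD.continuous_imqKernel hT.continuous
  have hb := KernelMMD.abs_imqKernel_le_one T
  refine ⟨hk, hc.measurable, fun P => KernelMMD.integrable_feature _ hc hb _, fun P Q hPQ => ?_⟩
  have h0 : KernelMMD.sqMMD (KernelMMD.imqKernel T) (P : Measure X) (Q : Measure X) = 0 := by
    rw [← KernelMMD.norm_integral_feature_sub_sq _ hc hb, sq_eq_zero_iff, norm_sub_eq_zero_iff]
    exact hPQ
  have h1 := KernelMMD.sqMMD_comp hT.measurable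
    (KernelMMD.continuous_imqKernel (continuous_id (X := Y))) (P : Measure X) (Q : Measure X)
  have h2 := KernelMMD.eq_of_sqMMD_imqKernel_id_eq_zero (h1.symm.trans h0)
  -- By the Lusin–Souslin theorem `T` is a measurable embedding.
  exact Subtype.ext
    ((hT.continuous.measurableEmbedding hT.injective).map_injective h2)
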